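/- Consider the bilateral trade problem with realistic feedback. At each round $t=1,2,\dots$ a seller and a buyer arrive with hidden valuations $(S_t,B_t)\in[0,1]^2$; the learner posts a price $P_t\in[0,1]$, collects the (unobserved) reward $\mathrm{gft}(P_t,S_t,B_t)$, where $\mathrm{gft}(p,s,b):=(b-s)\,\mathbb{I}\{s\le p\le b\}$, and observes only the feedback $Z_t=(\mathbb{I}\{S_t\le P_t\},\,\mathbb{I}\{P_t\le B_t\})\in\{0,1\}^2$. A strategy $\alpha$ of the learner is a sequence of measurable functions $\alpha_t\colon[0,1]^t\times(\{0,1\}^2)^{t-1}\to[0,1]$, which post $P_t=\alpha_t(U_1,\dots,U_t,Z_1,\dots,Z_{t-1})$, where $U_1,U_2,\dots$ are i.i.d. uniform on $[0,1]$ and independent of the valuations. For $M>0$ let $\mathscr{P}_M$ be the set of all laws of sequences $(S_1,B_1),(S_2,B_2),\dots$ such that (iid) the pairs $(S_t,B_t)$ are i.i.d.; (iv) $S_1$ and $B_1$ are independent of each other; (bd) $S_1$ and $B_1$ each admit a density with respect to the Lebesgue measure on $[0,1]$ that is bounded by $M$. For a horizon $T$, define the minimax regret \[ R_T^\star(M):=\inf_{\alpha}\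 \sup_{\mathbf{P}\in\mathscr{P}_M}\ \sup_{p\in[0,1]}\ \mathbb{E}\left[\sum_{t=1}^T \mathrm{gft}(p,S_t,B_t)-\sum_{t=1}^T \mathrm{gft}(P_t,S_t,B_t)\right], \] where the infimum is over all strategies $\alpha$ of the learner and the expectation is with respect to the valuations, of law $\mathbf{P}$, and the randomization $(U_t)_t$. Theorem. For every $M\ge 24$ and every horizon $T\in\mathbb{N}$, \[ R_T^\star(M)\ \ge\ \frac{11}{672}\,T^{2/3}. \] -/

import Mathlib

open MeasureTheory
open scoped unitInterval

namespace BilateralTrade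

/-- Gain from trade `gft(p, (s, b)) = (b - s) 𝟙{s ≤ p ≤ b}` of a price `p` for a seller/buyer
pair of valuations `y = (s, b)`. -/
noncomputable def gft (p : I) (y : I × I) : ℝ :=
  if y.1 ≤ p ∧ p ≤ y.2 then (y.2 : ℝ) - (y.1 : ℝ) else 0

/-- Realistic feedback `(𝟙{s ≤ p}, 𝟙{p ≤ b})`. -/
noncomputable def realisticFeedback (p : I) (y : I × I) : Bool × Bool :=
  (decide (y.1 ≤ p), decide (p ≤ y.2))

/-- A (randomized) strategy of the learner under realistic feedback. Rounds are numbered from `0`: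
in round `t` the posted price is a measurable function of the uniform seeds `u₀, …, u_t` and of
the feedback `z₀, …, z_{t-1}` received in the previous rounds. -/
structure Strategy where
  price : (t : ℕ) → (Fin (t + 1) → I) × (Fin t → Bool × Bool) → I
  measurable_price : ∀ t, Measurable (price t)

/-- The feedback `z₀, …, z_{t-1}` received before round `t` when the strategy `α` plays against
the valuations `y₀, y₁, …` with the seeds `u₀, u₁, …`. -/
noncomputable def Strategy.history (α : Strategy) (y : ℕ → I × I) (u : ℕ → I) :
    (t : ℕ) → Fin t → Bool × Bool
  | 0 => fun i => i.elim0
  | t + 1 => Fin.snoc (α := fun _ => Bool × Bool) (α.history y u t)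
      (realisticFeedback (α.price t (fun i => u i, α.history y u t)) (y t))

/-- The price posted in round `t`. -/
noncomputable def Strategy.play (α : Strategy) (y : ℕ → I × I) (u : ℕ → I) (t : ℕ) : I :=
  α.price t (fun i => u i, α.history y u t)

/-- A probability measure on `[0, 1]` with a density with respect to the Lebesgue measure that
is bounded by `M`. -/
def HasDensityBoundedBy (M : ℝ) (μ : Measure I) : Prop :=
  IsProbabilityMeasure μ ∧
    ∃ f : I → ℝ, Measurable f ∧ (∀ x, 0 ≤ f x ∧ f x ≤ M) ∧
      μ = volume.withDensity (fun x => ENNReal.ofReal (f x))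

/-- The laws of the sequence of valuations `(S₀, B₀), (S₁, B₁), …` that are i.i.d., with `S` and
`B` independent of each other, each with a density bounded by `M`. -/
def environments (M : ℝ) : Set (Measure (ℕ → I × I)) :=
  {P | ∃ μS μB : Measure I, HasDensityBoundedBy M μS ∧ HasDensityBoundedBy M μB ∧
    P = Measure.infinitePi (fun _ : ℕ => μS.prod μB)}

/-- The expected difference, over `T` rounds, between the gain from trade of the fixed price `p`
and that of the strategy `α`, where the valuations have law `P` and the seeds of the learner are
independent of them, i.i.d. and uniform on `[0, 1]`. -/
noncomputable def regretAgainst (T : ℕ) (P : Measure (ℕ → I × I)) (α : Strategy) (p : I) : ℝ :=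
  ∫ ω : (ℕ → I × I) × (ℕ → I),
    (∑ t ∈ Finset.range T, gft p (ω.1 t) -
      ∑ t ∈ Finset.range T, gft (α.play ω.1 ω.2 t) (ω.1 t))
    ∂(P.prod (Measure.infinitePi (fun _ : ℕ => (volume : Measure I))))

/-- The regret of `α` with respect to the best fixed price. -/
noncomputable def regret (T : ℕ) (P : Measure (ℕ → I × I)) (α : Strategy) : EReal :=
  ⨆ p : I, (regretAgainst T P α p : EReal)

/-- The minimax regret: infimum over the strategies of the worst-case regret over the
environments. -/
noncomputable def minimaxRegret (M : ℝ) (T : ℕ) : EReal :=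
  ⨅ α : Strategy, ⨆ P ∈ environments M, regret T P α

end BilateralTrade

/-! The lower bound comes from a two-point game. The seller has a low cluster, whose mass is tilted
by `ε` towards its left or right part, and a high cluster; the buyer's law is fixed. At `ε = 0` the
prices `lowPrice` and `highPrice` are equally good. A tilt of sign `+` makes the first better by `ε
/ 15`, and a tilt of sign `-` the second (`expectedGain_lowPrice`, `expectedGain_highPrice`). Prices
at or above `20 / 30` say nothing about the sign. A lower price reveals it only by splitting the low
cluster, which forgoes trades at a constant rate (`expectedGain_add_le`), while the information
gained is of order `ε ^ 2` times that cost (`sq_acceptProb_sub_le`).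

Information is measured by `affinity`, the sum over histories of `w * v / (w + v)`, where `w` and
`v` are the probabilities of the history under the two signs. In each round some hypothesis charges
at least `ε / 15` times the affinity, and the affinity drops by at most `2 * ε ^ 2 * D`, where `D`
is the weighted mass of low sellers lost, which costs `13 / 60 * D` (`halfHarmonic_round`). With `n`
rounds to go and `n * ε ^ 3 ≤ 1`, the cost of exploring exceeds its later benefit `n * (ε / 15) * (2
* ε ^ 2 * D)`. The affinity starts at `1 / 2`, so telescoping shows that the two regrets add up to
at least `T * ε / 30` for every choice of seeds (`le_sum_roundRegret`). The larger one is at least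
`T * ε / 60`, and `ε = T ^ (-1 / 3)` gives `T ^ (2 / 3) / 60`, which is above the claimed bound. -/

namespace BilateralTrade

/-! ### Half harmonic means and their loss under an observation. -/

/-- Half of the harmonic mean of two weights. -/
noncomputable def halfHarmonic (w v : ℝ) : ℝ := w * v / (w + v)

lemma halfHarmonic_le_left {w v : ℝ} (hw : 0 ≤ w) (hv : 0 ≤ v) : halfHarmonic w v ≤ w := by
  unfold halfHarmonic
  exact div_le_of_le_mul₀ (by positivity) hw (by nlinarith)

lemma halfHarmonic_le_right {w v : ℝ} (hw : 0 ≤ w) (hv : 0 ≤ v) : halfHarmonic w v ≤ v := by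
  unfold halfHarmonic
  exact div_le_of_le_mul₀ (by positivity) hv (by nlinarith)

/-- Homogeneity lets an observation with the same law under both hypotheses factor out. The
degenerate cases rely on `x / 0 = 0`. -/
lemma halfHarmonic_mul_right (w v c : ℝ) :
    halfHarmonic (w * c) (v * c) = halfHarmonic w v * c := by
  unfold halfHarmonic
  rcases eq_or_ne c 0 with rfl | hc
  · simp
  rcases eq_or_ne (w + v) 0 with h | h
  · have : w * c + v * c = 0 := by rw [← add_mul, h, zero_mul]
    simp [h, this]
  · have : w * c + v * c ≠ 0 := by rw [← add_mul]; exact mul_ne_zero h hc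
    field_simp

/-- The loss of the half harmonic mean of two weights when they are updated by the observation of
a Bernoulli variable of parameter `F` under the first hypothesis and `H` under the second. -/
lemma halfHarmonic_sub_le {w v F H ε : ℝ} (hw : 0 ≤ w) (hv : 0 ≤ v) (hF : 0 ≤ F) (hF' : F ≤ 1 / 2)
    (hH : 0 ≤ H) (hH' : H ≤ 1 / 2) (h : (F - H) ^ 2 ≤ 4 * ε ^ 2 * (F * (1 / 2 - H))) :
    halfHarmonic w v -
        (halfHarmonic (w * F) (v * H) + halfHarmonic (w * (1 - F)) (v * (1 - H))) ≤
      2 * ε ^ 2 * (w * (1 / 2 - F) + v * (1 / 2 - H)) := by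
  have hD : 0 ≤ w * (1 / 2 - F) + v * (1 / 2 - H) :=
    add_nonneg (mul_nonneg hw (by linarith)) (mul_nonneg hv (by linarith))
  have hR : 0 ≤ 2 * ε ^ 2 * (w * (1 / 2 - F) + v * (1 / 2 - H)) := by positivity
  rcases hw.eq_or_lt with rfl | hw
  · simpa [halfHarmonic] using hR
  rcases hv.eq_or_lt with rfl | hv
  · simpa [halfHarmonic] using hR
  rcases (show 0 ≤ w * F + v * H by positivity).eq_or_lt with hX | hX
  · have h1 : w * F = 0 := by nlinarith [mul_nonneg hw.le hF, mul_nonneg hv.le hH]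
    have h2 : v * H = 0 := by nlinarith [mul_nonneg hw.le hF, mul_nonneg hv.le hH]
    have hF0 : F = 0 := by simpa [hw.ne'] using h1
    have hH0 : H = 0 := by simpa [hv.ne'] using h2
    subst hF0 hH0
    simpa [halfHarmonic] using hR
  have hY : (w + v) / 2 ≤ w * (1 - F) + v * (1 - H) := by nlinarith
  have hY0 : 0 < w * (1 - F) + v * (1 - H) := by linarith
  -- The loss is an exact chi-square-like expression, quadratic in `F - H`.
  have hid : halfHarmonic w v -
        (halfHarmonic (w * F) (v * H) + halfHarmonic (w * (1 - F)) (v * (1 - H))) =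
      (w * v) ^ 2 * (F - H) ^ 2 /
        ((w + v) * (w * F + v * H) * (w * (1 - F) + v * (1 - H))) := by
    unfold halfHarmonic
    have := hX.ne'
    have := hY0.ne'
    have : w + v ≠ 0 := by positivity
    field_simp
    ring
  rw [hid, div_le_iff₀ (by positivity)]
  have h1 : (w * v) ^ 2 * (F - H) ^ 2 ≤ (w * v) ^ 2 * (4 * ε ^ 2 * (F * (1 / 2 - H))) := by gcongr
  -- The factor `F` is absorbed by the first denominator, and `1 / 2 - H` by the exploration cost.
  have h2 : (w * F) * (v * (1 / 2 - H)) ≤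
      (w * F + v * H) * (w * (1 / 2 - F) + v * (1 / 2 - H)) := by
    have : 0 ≤ v * (1 / 2 - H) := mul_nonneg hv.le (by linarith)
    gcongr
    · nlinarith [mul_nonneg hv.le hH]
    · nlinarith [mul_nonneg hw.le (show 0 ≤ 1 / 2 - F by linarith)]
  -- AM-GM combined with `hY`.
  have h3 : 4 * (w * v) ≤ (w + v) * (2 * (w * (1 - F) + v * (1 - H))) := by
    nlinarith [sq_nonneg (w - v)]
  calc (w * v) ^ 2 * (F - H) ^ 2 ≤ (w * v) ^ 2 * (4 * ε ^ 2 * (F * (1 / 2 - H))) := h1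
    _ = ε ^ 2 * ((4 * (w * v)) * ((w * F) * (v * (1 / 2 - H)))) := by ring
    _ ≤ ε ^ 2 * (((w + v) * (2 * (w * (1 - F) + v * (1 - H)))) *
          ((w * F + v * H) * (w * (1 / 2 - F) + v * (1 / 2 - H)))) := by
        have : 0 ≤ v * (1 / 2 - H) := mul_nonneg hv.le (by linarith)
        gcongr
    _ = _ := by ring

lemma integrable_of_measurable_of_bounded {X : Type*} [MeasurableSpace X] {μ : Measure X}
    [IsFiniteMeasure μ] {f : X → ℝ} {C : ℝ} (hf : Measurable f) (h : ∀ x, |f x| ≤ C) :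
    Integrable f μ :=
  Integrable.of_bound hf.aestronglyMeasurable C (.of_forall h)

/-! ### Histograms on the unit interval -/

/-- The index of the interval `[k / 30, (k + 1) / 30)` that contains `x`. -/
noncomputable def binIndex (x : I) : ℕ := ⌊30 * (x : ℝ)⌋₊

lemma measurable_binIndex : Measurable binIndex :=
  Nat.measurable_floor.comp (measurable_subtype_coe.const_mul 30)

lemma binIndex_eq_iff {x : I} {k : ℕ} :
    binIndex x = k ↔ (k : ℝ) / 30 ≤ x ∧ (x : ℝ) < (k + 1) / 30 := by
  rw [binIndex, Nat.floor_eq_iff (by have := x.2.1; positivity), div_le_iff₀' (by norm_num),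
    lt_div_iff₀' (by norm_num)]

/-- Index `30` occurs only at `x = 1`, so sums run over 31 bins although 30 have positive length. -/
lemma binIndex_lt (x : I) : binIndex x < 31 := by
  rw [binIndex, Nat.floor_lt (by have := x.2.1; positivity)]
  have := x.2.2
  push_cast
  linarith

/-- The measure with mass `c k`, uniformly spread, on `[k / 30, (k + 1) / 30)`. -/
noncomputable def histogram (c : ℕ → ℝ) : Measure I :=
  volume.withDensity (fun x => ENNReal.ofReal (30 * c (binIndex x)))

/-- The average of `φ` on `[k / 30, (k + 1) / 30)`. -/
noncomputable def binAverage (k : ℕ) (φ : I → ℝ) : ℝ := 30 * ∫ x in binIndex ⁻¹' {k}, φ x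

lemma measurable_comp_binIndex (c : ℕ → ℝ) : Measurable fun x => c (binIndex x) :=
  (measurable_from_top (f := c)).comp measurable_binIndex

lemma measurableSet_bin (k : ℕ) : MeasurableSet (binIndex ⁻¹' {k}) :=
  measurable_binIndex (measurableSet_singleton k)

lemma integral_histogram {c : ℕ → ℝ} (hc : ∀ k, 0 ≤ c k) {φ : I → ℝ} {C : ℝ} (hφ : Measurable φ)
    (hC : ∀ x, |φ x| ≤ C) :
    ∫ x, φ x ∂histogram c = ∑ k ∈ Finset.range 31, c k * binAverage k φ := by
  have hint : Integrable φ (volume : Measure I) := integrable_of_measurable_of_bounded hφ hC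
  rw [histogram, integral_withDensity_eq_integral_toReal_smul₀
    ((measurable_comp_binIndex c).const_mul 30).ennreal_ofReal.aemeasurable
    (.of_forall fun x => ENNReal.ofReal_lt_top)]
  have hpt : ∀ x, (ENNReal.ofReal (30 * c (binIndex x))).toReal • φ x =
      ∑ k ∈ Finset.range 31, (c k * 30) * (binIndex ⁻¹' {k}).indicator φ x := by
    intro x
    rw [Finset.sum_eq_single_of_mem (binIndex x) (Finset.mem_range.2 (binIndex_lt x)),
      ENNReal.toReal_ofReal (mul_nonneg (by norm_num) (hc _))]
    · simp [mul_comm]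
    · intro k _ hk
      simp [hk.symm]
  simp_rw [hpt]
  rw [integral_finsetSum _ fun k _ => (hint.indicator (measurableSet_bin k)).const_mul _]
  refine Finset.sum_congr rfl fun k _ => ?_
  rw [integral_const_mul, integral_indicator (measurableSet_bin k), binAverage, mul_assoc]

lemma bin_eq_preimage (k : ℕ) :
    binIndex ⁻¹' {k} = ((↑) : I → ℝ) ⁻¹' Set.Ico ((k : ℝ) / 30) ((k + 1) / 30) := by
  ext x
  simp [binIndex_eq_iff]

lemma setIntegral_bin {k : ℕ} (hk : k < 30) (φ : ℝ → ℝ) :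
    ∫ x in binIndex ⁻¹' {k}, φ x = ∫ x in (k : ℝ) / 30..(k + 1) / 30, φ x := by
  have hk' : (k : ℝ) + 1 ≤ 30 := by exact_mod_cast hk
  have h0 : (0 : ℝ) ≤ k := by positivity
  rw [bin_eq_preimage, unitInterval.measurePreserving_coe.setIntegral_preimage_emb
    unitInterval.measurableEmbedding_coe, Measure.restrict_restrict measurableSet_Ico,
    Set.inter_eq_left.2, intervalIntegral.integral_of_le (by gcongr; linarith),
    integral_Ico_eq_integral_Ioc]
  intro x hx
  exact ⟨by have := hx.1; have : 0 ≤ (k : ℝ) / 30 := by positivity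
            linarith, by have := hx.2; linarith⟩

lemma binAverage_const {k : ℕ} (hk : k < 30) (a : ℝ) : binAverage k (fun _ => a) = a := by
  rw [binAverage, setIntegral_bin hk (fun _ => a), intervalIntegral.integral_const, smul_eq_mul]
  ring

lemma binAverage_coe {k : ℕ} (hk : k < 30) :
    binAverage k (fun x => (x : ℝ)) = (k + 1 / 2) / 30 := by
  rw [binAverage, setIntegral_bin hk (fun x => x), integral_id]
  ring

lemma binAverage_congr {k : ℕ} {φ φ' : I → ℝ}
    (h : ∀ x : I, (k : ℝ) / 30 ≤ x → (x : ℝ) < (k + 1) / 30 → φ x = φ' x) :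
    binAverage k φ = binAverage k φ' := by
  unfold binAverage
  congr 1
  refine setIntegral_congr_fun (measurableSet_bin k) fun x hx => ?_
  have := binIndex_eq_iff.1 hx
  exact h x this.1 this.2

lemma binAverage_mono {k : ℕ} {φ φ' : I → ℝ} {C : ℝ} (hφ : Measurable φ) (hφ' : Measurable φ')
    (hC : ∀ x, |φ x| ≤ C) (hC' : ∀ x, |φ' x| ≤ C) (h : ∀ x, φ x ≤ φ' x) :
    binAverage k φ ≤ binAverage k φ' :=
  mul_le_mul_of_nonneg_left
    (integral_mono (integrable_of_measurable_of_bounded hφ hC)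
      (integrable_of_measurable_of_bounded hφ' hC') h) (by norm_num)

lemma isProbabilityMeasure_histogram {c : ℕ → ℝ} (hc : ∀ k, 0 ≤ c k) (h30 : c 30 = 0)
    (hsum : ∑ k ∈ Finset.range 30, c k = 1) : IsProbabilityMeasure (histogram c) := by
  have hfin : IsFiniteMeasure (histogram c) := by
    refine isFiniteMeasure_withDensity_ofReal (Integrable.hasFiniteIntegral (μ := volume) ?_)
    refine integrable_of_measurable_of_bounded (C := 30 * ∑ k ∈ Finset.range 31, c k)
      ((measurable_comp_binIndex c).const_mul 30) fun x => ?_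
    rw [abs_of_nonneg (mul_nonneg (by norm_num) (hc _))]
    gcongr
    exact Finset.single_le_sum (f := c) (fun k _ => hc k) (Finset.mem_range.2 (binIndex_lt x))
  have h := integral_histogram hc (φ := fun _ => 1) (C := 1) measurable_const (by simp)
  rw [Finset.sum_range_succ, h30, zero_mul, add_zero, integral_const, smul_eq_mul, mul_one,
    Finset.sum_congr rfl (fun k hk => by
      rw [binAverage_const (Finset.mem_range.1 hk), mul_one]), hsum] at h
  refine ⟨?_⟩
  rw [← ENNReal.toReal_eq_one_iff]
  exact h

lemma hasDensityBoundedBy_histogram {c : ℕ → ℝ} (hc : ∀ k, 0 ≤ c k) (h30 : c 30 = 0)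
    (hsum : ∑ k ∈ Finset.range 30, c k = 1) {M : ℝ} (hM : ∀ k, 30 * c k ≤ M) :
    HasDensityBoundedBy M (histogram c) :=
  ⟨isProbabilityMeasure_histogram hc h30 hsum, fun x => 30 * c (binIndex x),
    (measurable_comp_binIndex c).const_mul 30,
    fun x => ⟨mul_nonneg (by norm_num) (hc _), hM _⟩, rfl⟩

lemma ae_histogram {c : ℕ → ℝ} : ∀ᵐ x ∂histogram c, c (binIndex x) ≠ 0 := by
  rw [histogram, ae_withDensity_iff ((measurable_comp_binIndex c).const_mul 30).ennreal_ofReal]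
  refine .of_forall fun x hx h => hx ?_
  simp [h]

/-! ### The hard instances -/

/-- Masses of the seller's valuation: a low cluster split between two intervals, the split being
perturbed by `ε`, and a high cluster. -/
noncomputable def sellerMass (ε : ℝ) (k : ℕ) : ℝ :=
  if k = 0 then (1 + ε) / 4 else if k = 16 then (1 - ε) / 4 else if k = 20 then 1 / 2 else 0

/-- Masses of the buyer's valuation. -/
noncomputable def buyerMass (k : ℕ) : ℝ :=
  if k = 17 then 1 / 2 else if k = 29 then 1 / 2 else 0

noncomputable def sellerLaw (ε : ℝ) : Measure I := histogram (sellerMass ε)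

noncomputable def buyerLaw : Measure I := histogram buyerMass

lemma sellerMass_nonneg {ε : ℝ} (hε : |ε| ≤ 1) (k : ℕ) : 0 ≤ sellerMass ε k := by
  obtain ⟨h1, h2⟩ := abs_le.1 hε
  unfold sellerMass
  split_ifs <;> linarith

lemma buyerMass_nonneg (k : ℕ) : 0 ≤ buyerMass k := by
  unfold buyerMass
  split_ifs <;> norm_num

lemma hasDensityBoundedBy_sellerLaw {ε M : ℝ} (hε : |ε| ≤ 1) (hM : 24 ≤ M) :
    HasDensityBoundedBy M (sellerLaw ε) := by
  obtain ⟨h1, h2⟩ := abs_le.1 hε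
  refine hasDensityBoundedBy_histogram (sellerMass_nonneg hε) (by simp [sellerMass]) ?_ fun k => ?_
  · simp [Finset.sum_range_succ, sellerMass]
    ring
  · unfold sellerMass
    split_ifs <;> linarith

lemma hasDensityBoundedBy_buyerLaw {M : ℝ} (hM : 24 ≤ M) : HasDensityBoundedBy M buyerLaw := by
  refine hasDensityBoundedBy_histogram buyerMass_nonneg (by simp [buyerMass]) ?_ fun k => ?_
  · simp [Finset.sum_range_succ, buyerMass]
    norm_num
  · unfold buyerMass
    split_ifs <;> linarith

lemma isProbabilityMeasure_sellerLaw {ε : ℝ} (hε : |ε| ≤ 1) :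
    IsProbabilityMeasure (sellerLaw ε) := (hasDensityBoundedBy_sellerLaw hε le_rfl).1

instance : IsProbabilityMeasure buyerLaw := (hasDensityBoundedBy_buyerLaw le_rfl).1

lemma integral_sellerLaw {ε : ℝ} (hε : |ε| ≤ 1) {φ : I → ℝ} {C : ℝ} (hφ : Measurable φ)
    (hC : ∀ x, |φ x| ≤ C) :
    ∫ x, φ x ∂sellerLaw ε = (1 + ε) / 4 * binAverage 0 φ + (1 - ε) / 4 * binAverage 16 φ +
      1 / 2 * binAverage 20 φ := by
  rw [sellerLaw, integral_histogram (sellerMass_nonneg hε) hφ hC]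
  simp [Finset.sum_range_succ, sellerMass]

lemma integral_buyerLaw {φ : I → ℝ} {C : ℝ} (hφ : Measurable φ) (hC : ∀ x, |φ x| ≤ C) :
    ∫ x, φ x ∂buyerLaw = 1 / 2 * binAverage 17 φ + 1 / 2 * binAverage 29 φ := by
  rw [buyerLaw, integral_histogram buyerMass_nonneg hφ hC]
  simp [Finset.sum_range_succ, buyerMass]

lemma ae_sellerLaw (ε : ℝ) :
    ∀ᵐ s : I ∂sellerLaw ε, (s : ℝ) ≤ 17 / 30 ∨ 20 / 30 ≤ (s : ℝ) ∧ (s : ℝ) ≤ 21 / 30 := by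
  filter_upwards [ae_histogram (c := sellerMass ε)] with s hs
  by_cases h0 : binIndex s = 0
  · have := binIndex_eq_iff.1 h0
    norm_num at this
    left; linarith [this.2]
  by_cases h1 : binIndex s = 16
  · have := binIndex_eq_iff.1 h1
    norm_num at this
    left; linarith [this.2]
  by_cases h2 : binIndex s = 20
  · have := binIndex_eq_iff.1 h2
    norm_num at this
    right; constructor <;> linarith [this.1, this.2]
  simp [sellerMass, h0, h1, h2] at hs

lemma ae_buyerLaw :
    ∀ᵐ b : I ∂buyerLaw, (17 / 30 ≤ (b : ℝ) ∧ (b : ℝ) ≤ 18 / 30) ∨ 29 / 30 ≤ (b : ℝ) := by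
  filter_upwards [ae_histogram (c := buyerMass)] with s hs
  by_cases h0 : binIndex s = 17
  · have := binIndex_eq_iff.1 h0
    norm_num at this
    left; constructor <;> linarith [this.1, this.2]
  by_cases h1 : binIndex s = 29
  · have := binIndex_eq_iff.1 h1
    norm_num at this
    right; linarith [this.1]
  simp [buyerMass, h0, h1] at hs

/-! ### Distribution function of the seller -/

/-- The probability that the seller accepts the price `p`. -/
noncomputable def acceptProb (ε : ℝ) (p : I) : ℝ := (sellerLaw ε).real (Set.Iic p)

lemma acceptProb_nonneg (ε : ℝ) (p : I) : 0 ≤ acceptProb ε p := measureReal_nonneg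

/-- Indicator that a seller with valuation `s` accepts the price `p`. -/
noncomputable def accepts (p s : I) : ℝ := if s ≤ p then 1 else 0

/-- Indicator that a buyer with valuation `b` accepts the price `p`. -/
noncomputable def buys (p b : I) : ℝ := if p ≤ b then 1 else 0

lemma measurable_accepts (p : I) : Measurable (accepts p) :=
  Measurable.ite measurableSet_Iic measurable_const measurable_const

lemma measurable_buys (p : I) : Measurable (buys p) :=
  Measurable.ite measurableSet_Ici measurable_const measurable_const

lemma accepts_nonneg (p s : I) : 0 ≤ accepts p s := by unfold accepts; split_ifs <;> norm_num

lemma accepts_le_one (p s : I) : accepts p s ≤ 1 := by unfold accepts; split_ifs <;> norm_num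

lemma buys_nonneg (p s : I) : 0 ≤ buys p s := by unfold buys; split_ifs <;> norm_num

lemma buys_le_one (p s : I) : buys p s ≤ 1 := by unfold buys; split_ifs <;> norm_num

lemma abs_accepts_le (p s : I) : |accepts p s| ≤ 1 := by
  rw [abs_of_nonneg (accepts_nonneg p s)]; exact accepts_le_one p s

lemma abs_buys_le (p s : I) : |buys p s| ≤ 1 := by
  rw [abs_of_nonneg (buys_nonneg p s)]; exact buys_le_one p s

lemma abs_coe_le (s : I) : |(s : ℝ)| ≤ 1 := by
  rw [abs_of_nonneg s.2.1]; exact s.2.2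

lemma abs_mul_le_one {a b : ℝ} (ha : |a| ≤ 1) (hb : |b| ≤ 1) : |a * b| ≤ 1 := by
  rw [abs_mul]; exact mul_le_one₀ ha (abs_nonneg b) hb

lemma measurable_accepts_mul_coe (p : I) : Measurable fun s : I => accepts p s * (s : ℝ) :=
  (measurable_accepts p).mul measurable_subtype_coe

lemma measurable_buys_mul_coe (p : I) : Measurable fun b : I => buys p b * (b : ℝ) :=
  (measurable_buys p).mul measurable_subtype_coe

lemma abs_accepts_mul_coe_le (p s : I) : |accepts p s * (s : ℝ)| ≤ 1 :=
  abs_mul_le_one (abs_accepts_le p s) (abs_coe_le s)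

lemma abs_buys_mul_coe_le (p b : I) : |buys p b * (b : ℝ)| ≤ 1 :=
  abs_mul_le_one (abs_buys_le p b) (abs_coe_le b)

lemma integral_accepts (ε : ℝ) (p : I) : ∫ s, accepts p s ∂sellerLaw ε = acceptProb ε p := by
  have : accepts p = (Set.Iic p).indicator 1 := by
    ext s; simp [accepts, Set.indicator_apply]
  rw [this, integral_indicator_one measurableSet_Iic, acceptProb]

lemma acceptProb_eq {ε : ℝ} (hε : |ε| ≤ 1) (p : I) :
    acceptProb ε p = (1 + ε) / 4 * binAverage 0 (accepts p) +
      (1 - ε) / 4 * binAverage 16 (accepts p) + 1 / 2 * binAverage 20 (accepts p) := by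
  rw [← integral_accepts, integral_sellerLaw hε (measurable_accepts p) (abs_accepts_le p)]

lemma binAverage_accepts_of_le {k : ℕ} (hk : k < 30) {p : I} (hp : ((k : ℝ) + 1) / 30 ≤ p) :
    binAverage k (accepts p) = 1 := by
  rw [← binAverage_const hk 1]
  refine binAverage_congr fun x _ hx => ?_
  rw [accepts, if_pos]
  exact Subtype.coe_le_coe.1 (hx.le.trans hp)

lemma binAverage_accepts_of_lt {k : ℕ} (hk : k < 30) {p : I} (hp : (p : ℝ) < k / 30) :
    binAverage k (accepts p) = 0 := by
  rw [← binAverage_const hk 0]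
  refine binAverage_congr fun x hx _ => ?_
  rw [accepts, if_neg]
  exact not_le.2 (Subtype.coe_lt_coe.1 (hp.trans_le hx))

lemma binAverage_accepts_nonneg {k : ℕ} (hk : k < 30) (p : I) : 0 ≤ binAverage k (accepts p) := by
  rw [← binAverage_const hk 0]
  exact binAverage_mono (C := 1) measurable_const (measurable_accepts p) (by simp)
    (abs_accepts_le p) (accepts_nonneg p)

lemma binAverage_accepts_le_one {k : ℕ} (hk : k < 30) (p : I) :
    binAverage k (accepts p) ≤ 1 := by
  rw [← binAverage_const hk 1]
  exact binAverage_mono (C := 1) (measurable_accepts p) measurable_const (abs_accepts_le p)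
    (by simp) (accepts_le_one p)

/-- Prices above the low cluster of the seller reveal nothing about the sign of `ε`. -/
lemma acceptProb_neg_eq {ε : ℝ} (hε : |ε| ≤ 1) {p : I} (hp : 20 / 30 ≤ (p : ℝ)) :
    acceptProb (-ε) p = acceptProb ε p := by
  rw [acceptProb_eq hε, acceptProb_eq (by rwa [abs_neg]),
    binAverage_accepts_of_le (k := 0) (by norm_num) (by norm_num at *; linarith),
    binAverage_accepts_of_le (k := 16) (by norm_num) (by norm_num at *; linarith)]
  ring

lemma acceptProb_le_half {ε : ℝ} (hε : |ε| ≤ 1) {p : I} (hp : (p : ℝ) < 20 / 30) :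
    acceptProb ε p ≤ 1 / 2 := by
  obtain ⟨h1, h2⟩ := abs_le.1 hε
  rw [acceptProb_eq hε, binAverage_accepts_of_lt (k := 20) (by norm_num) (by norm_num at *; linarith)]
  have hA := binAverage_accepts_le_one (k := 0) (by norm_num) p
  have hC := binAverage_accepts_le_one (k := 16) (by norm_num) p
  nlinarith

/-- The information in the seller's answer vanishes as soon as the low cluster is accepted entirely
or rejected entirely. This is exactly the hypothesis needed in `halfHarmonic_sub_le`. -/
lemma sq_acceptProb_sub_le {ε : ℝ} (h0 : 0 ≤ ε) (h1 : ε ≤ 1) {p : I} (hp : (p : ℝ) < 20 / 30) :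
    (acceptProb ε p - acceptProb (-ε) p) ^ 2 ≤
      4 * ε ^ 2 * (acceptProb ε p * (1 / 2 - acceptProb (-ε) p)) := by
  have hε : |ε| ≤ 1 := abs_le.2 ⟨by linarith, h1⟩
  rw [acceptProb_eq hε, acceptProb_eq (by rwa [abs_neg]),
    binAverage_accepts_of_lt (k := 20) (by norm_num) (by norm_num at *; linarith)]
  set A := binAverage 0 (accepts p) with hAdef
  set C := binAverage 16 (accepts p) with hCdef
  have hA0 : 0 ≤ A := binAverage_accepts_nonneg (by norm_num) p
  have hC0 : 0 ≤ C := binAverage_accepts_nonneg (by norm_num) p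
  have hA1 : A ≤ 1 := binAverage_accepts_le_one (by norm_num) p
  have hC1 : C ≤ 1 := binAverage_accepts_le_one (by norm_num) p
  -- A price cannot cut both bins: bin 16 lies to the right of bin 0.
  have hAC : C = 0 ∨ A = 1 := by
    rcases lt_or_ge (p : ℝ) (16 / 30) with h | h
    · exact .inl (binAverage_accepts_of_lt (by norm_num) (by norm_num at *; linarith))
    · exact .inr (binAverage_accepts_of_le (by norm_num) (by norm_num at *; linarith))
  have hsq : (A - C) ^ 2 ≤ A * (1 - C) := by
    rcases hAC with h | h <;> rw [h] <;> nlinarith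
  have hle : C ≤ A := by rcases hAC with h | h <;> rw [h] <;> assumption
  have hF : A / 4 ≤ (1 + ε) / 4 * A + (1 - ε) / 4 * C + 1 / 2 * 0 := by nlinarith
  have hH : (1 - C) / 4 ≤
      1 / 2 - ((1 + -ε) / 4 * A + (1 - -ε) / 4 * C + 1 / 2 * 0) := by nlinarith
  calc _ = ε ^ 2 * (A - C) ^ 2 / 4 := by ring
    _ ≤ ε ^ 2 * (A * (1 - C)) / 4 := by gcongr
    _ = 4 * ε ^ 2 * (A / 4 * ((1 - C) / 4)) := by ring
    _ ≤ _ := by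
        have : 0 ≤ (1 - C) / 4 := by linarith
        gcongr

/-! ### Expected gain from trade -/

/-- The expected gain from trade of the price `p`. -/
noncomputable def expectedGain (ε : ℝ) (p : I) : ℝ :=
  ∫ y, gft p y ∂(sellerLaw ε).prod buyerLaw

lemma gft_eq (p : I) (y : I × I) :
    gft p y = accepts p y.1 * (buys p y.2 * y.2) - accepts p y.1 * y.1 * buys p y.2 := by
  unfold gft accepts buys
  by_cases h1 : y.1 ≤ p <;> by_cases h2 : p ≤ y.2 <;> simp [h1, h2]

lemma measurableSet_seller_accepts : MeasurableSet {z : I × (I × I) | z.2.1 ≤ z.1} :=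
  measurableSet_le (f := fun z : I × (I × I) => z.2.1) (g := fun z => z.1)
    measurable_snd.fst measurable_fst

lemma measurableSet_buyer_accepts : MeasurableSet {z : I × (I × I) | z.1 ≤ z.2.2} :=
  measurableSet_le (f := fun z : I × (I × I) => z.1) (g := fun z => z.2.2)
    measurable_fst measurable_snd.snd

lemma measurable_gft : Measurable fun z : I × (I × I) => gft z.1 z.2 := by
  unfold gft
  refine Measurable.ite ?_ ?_ measurable_const
  · exact measurableSet_seller_accepts.inter measurableSet_buyer_accepts
  · exact measurable_snd.snd.subtype_coe.sub measurable_snd.fst.subtype_coe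

lemma gft_nonneg (p : I) (y : I × I) : 0 ≤ gft p y := by
  unfold gft
  split_ifs with h
  · exact sub_nonneg.2 (Subtype.coe_le_coe.2 (h.1.trans h.2))
  · exact le_rfl

lemma abs_gft_le (p : I) (y : I × I) : |gft p y| ≤ 1 := by
  rw [abs_of_nonneg (gft_nonneg p y)]
  unfold gft
  have := y.2.2.2
  have := y.1.2.1
  split_ifs <;> linarith

lemma integrable_gft {μ : Measure (I × I)} [IsFiniteMeasure μ] (p : I) : Integrable (gft p) μ :=
  integrable_of_measurable_of_bounded (measurable_gft.comp measurable_prodMk_left) (abs_gft_le p)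

lemma expectedGain_eq {ε : ℝ} (hε : |ε| ≤ 1) (p : I) :
    expectedGain ε p = acceptProb ε p * ∫ b, buys p b * b ∂buyerLaw -
      (∫ s, accepts p s * s ∂sellerLaw ε) * ∫ b, buys p b ∂buyerLaw := by
  have := isProbabilityMeasure_sellerLaw hε
  unfold expectedGain
  simp_rw [gft_eq]
  rw [integral_sub, integral_prod_mul (fun s => accepts p s) (fun b : I => buys p b * (b : ℝ)),
    integral_prod_mul (fun s : I => accepts p s * (s : ℝ)) (fun b => buys p b), integral_accepts]
  · exact integrable_of_measurable_of_bounded (C := 1)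
      (((measurable_accepts p).comp measurable_fst).mul ((measurable_buys_mul_coe p).comp
        measurable_snd)) fun y => abs_mul_le_one (abs_accepts_le _ _) (abs_buys_mul_coe_le _ _)
  · exact integrable_of_measurable_of_bounded (C := 1)
      (((measurable_accepts_mul_coe p).comp measurable_fst).mul ((measurable_buys p).comp
        measurable_snd)) fun y => abs_mul_le_one (abs_accepts_mul_coe_le _ _) (abs_buys_le _ _)

/-- The best price when the seller's low cluster leans to the left. -/
noncomputable def lowPrice : I := ⟨17 / 30, by norm_num, by norm_num⟩

/-- The best price when the seller's low cluster leans to the right. -/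
noncomputable def highPrice : I := ⟨21 / 30, by norm_num, by norm_num⟩

lemma coe_lowPrice : (lowPrice : ℝ) = 17 / 30 := rfl

lemma coe_highPrice : (highPrice : ℝ) = 21 / 30 := rfl

lemma integral_coe_buyerLaw : ∫ b : I, (b : ℝ) ∂buyerLaw = 47 / 60 := by
  rw [integral_buyerLaw measurable_subtype_coe abs_coe_le, binAverage_coe (by norm_num),
    binAverage_coe (by norm_num)]
  norm_num

lemma acceptProb_lowPrice {ε : ℝ} (hε : |ε| ≤ 1) : acceptProb ε lowPrice = 1 / 2 := by
  rw [acceptProb_eq hε,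
    binAverage_accepts_of_le (by norm_num) (by rw [coe_lowPrice]; norm_num),
    binAverage_accepts_of_le (by norm_num) (by rw [coe_lowPrice]; norm_num),
    binAverage_accepts_of_lt (by norm_num) (by rw [coe_lowPrice]; norm_num)]
  ring

lemma acceptProb_highPrice {ε : ℝ} (hε : |ε| ≤ 1) : acceptProb ε highPrice = 1 := by
  rw [acceptProb_eq hε,
    binAverage_accepts_of_le (by norm_num) (by rw [coe_highPrice]; norm_num),
    binAverage_accepts_of_le (by norm_num) (by rw [coe_highPrice]; norm_num),
    binAverage_accepts_of_le (by norm_num) (by rw [coe_highPrice]; norm_num)]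
  ring

lemma binAverage_accepts_mul_coe {k : ℕ} (hk : k < 30) {p : I} (hp : ((k : ℝ) + 1) / 30 ≤ p) :
    binAverage k (fun x => accepts p x * (x : ℝ)) = (k + 1 / 2) / 30 := by
  rw [← binAverage_coe hk]
  refine binAverage_congr fun x _ hx => ?_
  rw [accepts, if_pos (Subtype.coe_le_coe.1 (hx.le.trans hp)), one_mul]

lemma binAverage_accepts_mul_coe_of_lt {k : ℕ} (hk : k < 30) {p : I} (hp : (p : ℝ) < k / 30) :
    binAverage k (fun x => accepts p x * (x : ℝ)) = 0 := by
  rw [← binAverage_const hk 0]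
  refine binAverage_congr fun x hx _ => ?_
  have h : ¬ x ≤ p := not_le.2 (Subtype.coe_lt_coe.1 (hp.trans_le hx))
  rw [accepts, if_neg h, zero_mul]

lemma buys_eq_one {p b : I} (h : (p : ℝ) ≤ b) : buys p b = 1 := if_pos h

lemma buys_eq_zero {p b : I} (h : (b : ℝ) < p) : buys p b = 0 := if_neg (not_le.2 h)

/-- The tilt moves mass `ε / 4` left by `16 / 30`. Here every buyer accepts, so the gain moves by `8
* ε / 60`; at `highPrice` only half of the buyers accept, which halves the effect. -/
lemma expectedGain_lowPrice {ε : ℝ} (hε : |ε| ≤ 1) :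
    expectedGain ε lowPrice = (15 + 8 * ε) / 60 := by
  have hb : ∀ᵐ b : I ∂buyerLaw, buys lowPrice b = 1 := by
    filter_upwards [ae_buyerLaw] with b hb
    refine buys_eq_one ?_
    rw [coe_lowPrice]
    rcases hb with h | h <;> linarith [h]
  rw [expectedGain_eq hε, acceptProb_lowPrice hε,
    integral_congr_ae (g := fun b : I => (b : ℝ)) (by filter_upwards [hb] with b h; simp [h]),
    integral_congr_ae (g := fun _ => (1 : ℝ)) hb, integral_coe_buyerLaw,
    integral_sellerLaw hε (measurable_accepts_mul_coe _) (abs_accepts_mul_coe_le _),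
    binAverage_accepts_mul_coe (by norm_num) (by rw [coe_lowPrice]; norm_num),
    binAverage_accepts_mul_coe (by norm_num) (by rw [coe_lowPrice]; norm_num),
    binAverage_accepts_mul_coe_of_lt (by norm_num) (by rw [coe_lowPrice]; norm_num)]
  simp
  ring

lemma expectedGain_highPrice {ε : ℝ} (hε : |ε| ≤ 1) :
    expectedGain ε highPrice = (15 + 4 * ε) / 60 := by
  have h1 : binAverage 17 (buys highPrice) = 0 := by
    rw [← binAverage_const (k := 17) (by norm_num) 0]
    refine binAverage_congr fun x _ hx => buys_eq_zero ?_
    rw [coe_highPrice]; norm_num at *; linarith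
  have h2 : binAverage 29 (buys highPrice) = 1 := by
    rw [← binAverage_const (k := 29) (by norm_num) 1]
    refine binAverage_congr fun x hx _ => buys_eq_one ?_
    rw [coe_highPrice]; norm_num at *; linarith
  have h3 : binAverage 17 (fun b => buys highPrice b * (b : ℝ)) = 0 := by
    rw [← binAverage_const (k := 17) (by norm_num) 0]
    refine binAverage_congr fun x _ hx => ?_
    rw [buys_eq_zero, zero_mul]
    rw [coe_highPrice]; norm_num at *; linarith
  have h4 : binAverage 29 (fun b => buys highPrice b * (b : ℝ)) = 59 / 60 := by
    rw [show (59 / 60 : ℝ) = ((29 : ℕ) + 1 / 2) / 30 by norm_num,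
      ← binAverage_coe (k := 29) (by norm_num)]
    refine binAverage_congr fun x hx _ => ?_
    rw [buys_eq_one, one_mul]
    rw [coe_highPrice]; norm_num at *; linarith
  rw [expectedGain_eq hε, acceptProb_highPrice hε,
    integral_buyerLaw (measurable_buys _) (abs_buys_le _), h1, h2,
    integral_buyerLaw (measurable_buys_mul_coe _) (abs_buys_mul_coe_le _), h3, h4,
    integral_sellerLaw hε (measurable_accepts_mul_coe _) (abs_accepts_mul_coe_le _),
    binAverage_accepts_mul_coe (by norm_num) (by rw [coe_highPrice]; norm_num),
    binAverage_accepts_mul_coe (by norm_num) (by rw [coe_highPrice]; norm_num),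
    binAverage_accepts_mul_coe (by norm_num) (by rw [coe_highPrice]; norm_num)]
  push_cast
  ring

lemma ae_prod_clusters {ε : ℝ} (hε : |ε| ≤ 1) :
    ∀ᵐ y : I × I ∂(sellerLaw ε).prod buyerLaw,
      ((y.1 : ℝ) ≤ 17 / 30 ∨ 20 / 30 ≤ (y.1 : ℝ) ∧ (y.1 : ℝ) ≤ 21 / 30) ∧
      ((17 / 30 ≤ (y.2 : ℝ) ∧ (y.2 : ℝ) ≤ 18 / 30) ∨ 29 / 30 ≤ (y.2 : ℝ)) := by
  have := isProbabilityMeasure_sellerLaw hε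
  exact (Measure.quasiMeasurePreserving_fst.ae (ae_sellerLaw ε)).and
    (Measure.quasiMeasurePreserving_snd.ae ae_buyerLaw)

/-- A price in the low cluster of the seller forgoes trades that `lowPrice` makes. -/
lemma expectedGain_add_le {ε : ℝ} (hε : |ε| ≤ 1) {p : I} (hp : (p : ℝ) < 20 / 30) :
    expectedGain ε p + 13 / 60 * (1 / 2 - acceptProb ε p) ≤ expectedGain ε lowPrice := by
  have := isProbabilityMeasure_sellerLaw hε
  have ha : Measurable fun s => accepts lowPrice s - accepts p s :=
    (measurable_accepts _).sub (measurable_accepts _)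
  have hac : ∀ s, |accepts lowPrice s - accepts p s| ≤ 1 := fun s => abs_le.2
    ⟨by linarith [accepts_nonneg lowPrice s, accepts_le_one p s],
      by linarith [accepts_le_one lowPrice s, accepts_nonneg p s]⟩
  have hi : Integrable (fun y : I × I => (accepts lowPrice y.1 - accepts p y.1) *
      ((y.2 : ℝ) - 17 / 30)) ((sellerLaw ε).prod buyerLaw) := by
    refine integrable_of_measurable_of_bounded (C := 1) ((ha.comp measurable_fst).mul
      (measurable_snd.subtype_coe.sub_const _)) fun y => abs_mul_le_one (hac _) (abs_le.2 ⟨?_, ?_⟩)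
    · linarith [y.2.2.1]
    · linarith [y.2.2.2]
  -- A lost low seller would have traded for at least `b - 17 / 30`, whose mean is `47 / 60 - 34 /
  -- 60 = 13 / 60`.
  have hval : ∫ y : I × I, (accepts lowPrice y.1 - accepts p y.1) * ((y.2 : ℝ) - 17 / 30)
      ∂(sellerLaw ε).prod buyerLaw = 13 / 60 * (1 / 2 - acceptProb ε p) := by
    rw [integral_prod_mul (fun s => accepts lowPrice s - accepts p s)
        (fun b : I => (b : ℝ) - 17 / 30),
      integral_sub (integrable_of_measurable_of_bounded (measurable_accepts _) (abs_accepts_le _))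
        (integrable_of_measurable_of_bounded (measurable_accepts _) (abs_accepts_le _)),
      integral_sub (integrable_of_measurable_of_bounded measurable_subtype_coe abs_coe_le)
        (integrable_const _), integral_accepts, integral_accepts, acceptProb_lowPrice hε,
      integral_coe_buyerLaw]
    simp
    ring
  rw [← hval, expectedGain, expectedGain, ← integral_add (integrable_gft p) hi]
  refine integral_mono_ae ((integrable_gft p).add hi) (integrable_gft lowPrice) ?_
  filter_upwards [ae_prod_clusters hε] with y hy
  simp only [gft, accepts, ← Subtype.coe_le_coe, coe_lowPrice]
  obtain ⟨hs, hb⟩ := hy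
  have hb' : 17 / 30 ≤ (y.2 : ℝ) := by rcases hb with h | h <;> linarith [h]
  rcases hs with hs | hs
  · simp only [hs, hb', and_self, if_true]
    split_ifs <;> linarith
  · have h1 : ¬ (y.1 : ℝ) ≤ p := by linarith [hs.1]
    have h2 : ¬ (y.1 : ℝ) ≤ 17 / 30 := by linarith [hs.1]
    simp [h1, h2]

/-- Such a price already excludes the low buyers, while `highPrice` admits all sellers and all high
buyers. -/
lemma expectedGain_le_highPrice {ε : ℝ} (hε : |ε| ≤ 1) {p : I} (hp : 20 / 30 ≤ (p : ℝ)) :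
    expectedGain ε p ≤ expectedGain ε highPrice := by
  have := isProbabilityMeasure_sellerLaw hε
  refine integral_mono_ae (integrable_gft p) (integrable_gft highPrice) ?_
  filter_upwards [ae_prod_clusters hε] with y hy
  obtain ⟨hs, hb⟩ := hy
  have hs' : (y.1 : ℝ) ≤ 21 / 30 := by rcases hs with h | h <;> linarith [h]
  by_cases h : y.1 ≤ p ∧ p ≤ y.2
  · have h2 : (p : ℝ) ≤ y.2 := h.2
    have hb' : 29 / 30 ≤ (y.2 : ℝ) := by rcases hb with h | h <;> linarith [h]
    have h3 : y.1 ≤ highPrice ∧ highPrice ≤ y.2 := by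
      rw [← Subtype.coe_le_coe, ← Subtype.coe_le_coe, coe_highPrice]
      exact ⟨hs', by linarith⟩
    simp [gft, h, h3]
  · rw [gft, if_neg h]
    exact gft_nonneg _ _

/-! ### Feedback -/

/-- The probability of the feedback `o` at the price `p`. -/
noncomputable def feedbackProb (μ : Measure (I × I)) (p : I) (o : Bool × Bool) : ℝ :=
  μ.real {y | realisticFeedback p y = o}

/-- The expected posterior half harmonic mean after the feedback to a given price. -/
lemma sum_halfHarmonic_feedbackProb {ε : ℝ} (hε : |ε| ≤ 1) (w v : ℝ) (p : I) :
    ∑ o, halfHarmonic (w * feedbackProb ((sellerLaw ε).prod buyerLaw) p o)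
        (v * feedbackProb ((sellerLaw (-ε)).prod buyerLaw) p o) =
      halfHarmonic (w * acceptProb ε p) (v * acceptProb (-ε) p) +
        halfHarmonic (w * (1 - acceptProb ε p)) (v * (1 - acceptProb (-ε) p)) := by
  have h1 := isProbabilityMeasure_sellerLaw hε
  have h2 := isProbabilityMeasure_sellerLaw (ε := -ε) (by rwa [abs_neg])
  have key : ∀ (ε' : ℝ), IsProbabilityMeasure (sellerLaw ε') → ∀ o : Bool × Bool,
      feedbackProb ((sellerLaw ε').prod buyerLaw) p o =
      (if o.1 then acceptProb ε' p else 1 - acceptProb ε' p) *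
        (if o.2 then buyerLaw.real (Set.Ici p) else 1 - buyerLaw.real (Set.Ici p)) := by
    intro ε' _ o
    have hset : {y : I × I | realisticFeedback p y = o} =
        (if o.1 then Set.Iic p else (Set.Iic p)ᶜ) ×ˢ (if o.2 then Set.Ici p else (Set.Ici p)ᶜ) := by
      ext y
      rcases o with ⟨_ | _, _ | _⟩ <;> simp [realisticFeedback]
    have hA := probReal_compl_eq_one_sub (μ := sellerLaw ε') (measurableSet_Iic (a := p))
    have hB := probReal_compl_eq_one_sub (μ := buyerLaw) (measurableSet_Ici (a := p))
    rw [feedbackProb, hset, measureReal_prod_prod, acceptProb, ← hA, ← hB]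
    rcases o with ⟨_ | _, _ | _⟩ <;> rfl
  -- The buyer's bit is independent of the seller's and has the same law under both signs: its
  -- factor comes out and sums to one.
  simp_rw [key ε h1, key (-ε) h2, ← mul_assoc, halfHarmonic_mul_right]
  rw [Fintype.sum_prod_type]
  simp only [Fintype.sum_bool, if_true, Bool.false_eq_true, if_false]
  ring

/-- One round of the two-point Bayesian game. -/
lemma halfHarmonic_round {ε n w v : ℝ} (h0 : 0 ≤ ε) (h1 : ε ≤ 1) (hn0 : 0 ≤ n)
    (hn : n * ε ^ 3 ≤ 1) (hw : 0 ≤ w) (hv : 0 ≤ v) (p : I) :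
    (n + 1) * (ε / 15 * halfHarmonic w v) ≤
      w * (expectedGain ε lowPrice - expectedGain ε p) +
      v * (expectedGain (-ε) highPrice - expectedGain (-ε) p) +
      n * (ε / 15 * ∑ o, halfHarmonic (w * feedbackProb ((sellerLaw ε).prod buyerLaw) p o)
        (v * feedbackProb ((sellerLaw (-ε)).prod buyerLaw) p o)) := by
  have hε : |ε| ≤ 1 := abs_le.2 ⟨by linarith, h1⟩
  have hε' : |-ε| ≤ 1 := by rwa [abs_neg]
  have hl := expectedGain_lowPrice hε
  have hl' := expectedGain_lowPrice hε'
  have hh := expectedGain_highPrice hε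
  have hh' := expectedGain_highPrice hε'
  rw [sum_halfHarmonic_feedbackProb hε]
  -- A low price is wrong under `-ε` and may inform; a high price is wrong under `ε` and does not
  -- inform.
  rcases lt_or_ge (p : ℝ) (20 / 30) with hp | hp
  · have hF := acceptProb_le_half hε hp
    have hH := acceptProb_le_half hε' hp
    have hd := halfHarmonic_sub_le hw hv (acceptProb_nonneg ε p) hF (acceptProb_nonneg (-ε) p) hH
      (sq_acceptProb_sub_le h0 h1 hp)
    have e1 := mul_le_mul_of_nonneg_left (expectedGain_add_le hε hp) hw
    have e2 := mul_le_mul_of_nonneg_left (expectedGain_add_le hε' hp) hv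
    have e3 : ε / 15 * halfHarmonic w v ≤ ε / 15 * v := by
      gcongr; exact halfHarmonic_le_right hw hv
    set D := w * (1 / 2 - acceptProb ε p) + v * (1 / 2 - acceptProb (-ε) p) with hDdef
    have hD : 0 ≤ D := add_nonneg (mul_nonneg hw (by linarith)) (mul_nonneg hv (by linarith))
    have e4 := mul_le_mul_of_nonneg_left hd (show 0 ≤ n * (ε / 15) by positivity)
    have e5 : n * (ε / 15) * (2 * ε ^ 2 * D) ≤ 13 / 60 * D := by
      calc _ = (n * ε ^ 3) * (2 / 15 * D) := by ring
        _ ≤ 1 * (2 / 15 * D) := by gcongr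
        _ ≤ _ := by linarith
    rw [hh']
    rw [hl'] at e2
    linarith
  · rw [acceptProb_neg_eq hε hp, halfHarmonic_mul_right, halfHarmonic_mul_right]
    have e1 := mul_le_mul_of_nonneg_left (expectedGain_le_highPrice hε hp) hw
    have e2 := mul_le_mul_of_nonneg_left (expectedGain_le_highPrice hε' hp) hv
    have e3 : ε / 15 * halfHarmonic w v ≤ ε / 15 * w := by
      gcongr; exact halfHarmonic_le_left hw hv
    rw [hl]
    rw [hh] at e1
    linarith

/-! ### The process of histories -/

lemma measurable_realisticFeedback :
    Measurable fun z : I × (I × I) => realisticFeedback z.1 z.2 := by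
  unfold realisticFeedback
  refine Measurable.prodMk ?_ ?_
  · exact measurable_to_bool (by
      simpa [Set.preimage] using measurableSet_seller_accepts)
  · exact measurable_to_bool (by
      simpa [Set.preimage] using measurableSet_buyer_accepts)

lemma measurable_seeds (t : ℕ) :
    Measurable fun ω : (ℕ → I × I) × (ℕ → I) => fun i : Fin (t + 1) => ω.2 i :=
  measurable_pi_lambda _ fun i => (measurable_pi_apply (i : ℕ)).comp measurable_snd

lemma Strategy.measurable_history (α : Strategy) (t : ℕ) :
    Measurable fun ω : (ℕ → I × I) × (ℕ → I) => α.history ω.1 ω.2 t := by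
  induction t with
  | zero => exact measurable_const
  | succ t ih =>
    have hplay : Measurable fun ω : (ℕ → I × I) × (ℕ → I) =>
        α.price t (fun i => ω.2 i, α.history ω.1 ω.2 t) :=
      (α.measurable_price t).comp ((measurable_seeds t).prodMk ih)
    refine measurable_pi_lambda _ fun i => ?_
    refine Fin.lastCases ?_ (fun j => ?_) i
    · simp only [Strategy.history, Fin.snoc_last]
      exact measurable_realisticFeedback.comp
        (hplay.prodMk ((measurable_pi_apply t).comp measurable_fst))
    · simp only [Strategy.history, Fin.snoc_castSucc]
      exact (measurable_pi_apply j).comp ih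

lemma Strategy.measurable_play (α : Strategy) (t : ℕ) :
    Measurable fun ω : (ℕ → I × I) × (ℕ → I) => α.play ω.1 ω.2 t :=
  (α.measurable_price t).comp ((measurable_seeds t).prodMk (α.measurable_history t))

lemma Strategy.history_congr (α : Strategy) {y y' : ℕ → I × I} (u : ℕ → I) {t : ℕ}
    (h : ∀ i < t, y i = y' i) : α.history y u t = α.history y' u t := by
  induction t with
  | zero => rfl
  | succ t ih =>
    rw [Strategy.history, Strategy.history, ih fun i hi => h i (hi.trans t.lt_succ_self),
      h t t.lt_succ_self]

/-- The law of i.i.d. valuations with marginal `μ`. -/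
noncomputable def iidLaw (μ : Measure (I × I)) : Measure (ℕ → I × I) :=
  Measure.infinitePi fun _ => μ

instance (μ : Measure (I × I)) [IsProbabilityMeasure μ] : IsProbabilityMeasure (iidLaw μ) :=
  inferInstanceAs (IsProbabilityMeasure (Measure.infinitePi fun _ : ℕ => μ))

lemma integral_eval (μ : Measure (I × I)) [IsProbabilityMeasure μ] {φ : I × I → ℝ}
    (hφ : Measurable φ) (t : ℕ) : ∫ y, φ (y t) ∂iidLaw μ = ∫ y, φ y ∂μ := by
  conv_rhs => rw [← (measurePreserving_eval_infinitePi (fun _ : ℕ => μ) t).map_eq]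
  rw [integral_map (measurable_pi_apply t).aemeasurable hφ.aestronglyMeasurable]
  rfl

section

variable (α : Strategy) (u : ℕ → I) (μ : Measure (I × I))

/-- The probability of the history `z` when the seeds are `u`. -/
noncomputable def historyProb (t : ℕ) (z : Fin t → Bool × Bool) : ℝ :=
  (iidLaw μ).real {y | α.history y u t = z}

variable [IsProbabilityMeasure μ]

lemma indepFun_history (t : ℕ) :
    ProbabilityTheory.IndepFun (fun y => α.history y u t) (fun y : ℕ → I × I => y t)
      (iidLaw μ) := by
  have h := (ProbabilityTheory.iIndepFun_infinitePi (P := fun _ : ℕ => μ)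
    (X := fun _ y => y) (fun _ => measurable_id)).indepFun_finset (Finset.range t) {t} (by simp)
    (fun i => measurable_pi_apply i)
  -- Padding the first `t` valuations by an arbitrary value is harmless, as the history ignores the
  -- later ones (`history_congr`).
  let e : (Finset.range t → I × I) → ℕ → I × I := fun x i =>
    if hi : i ∈ Finset.range t then x ⟨i, hi⟩ else (0, 0)
  have he : Measurable e := by
    refine measurable_pi_lambda _ fun i => ?_
    by_cases hi : i ∈ Finset.range t
    · simp only [e, hi, dif_pos]
      exact measurable_pi_apply _
    · simp only [e, hi, dif_neg, not_false_eq_true]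
      exact measurable_const
  have hψ : Measurable fun x : ({t} : Finset ℕ) → I × I => x ⟨t, Finset.mem_singleton_self t⟩ :=
    measurable_pi_apply _
  have h2 := h.comp (φ := fun x => α.history (e x) u t)
    ((α.measurable_history t).comp (he.prodMk measurable_const)) hψ
  refine h2.congr (.of_forall fun y => ?_) (.of_forall fun y => rfl)
  refine α.history_congr u fun i hi => ?_
  simp [e, hi]

/-- Conditioning on the finitely many histories, which are independent of the current valuations. -/
lemma integral_history {t : ℕ} {φ : (Fin t → Bool × Bool) → I × I → ℝ}
    (hφ : ∀ z, Measurable (φ z)) (hC : ∀ z y, |φ z y| ≤ 1) :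
    ∫ y, φ (α.history y u t) (y t) ∂iidLaw μ =
      ∑ z, historyProb α u μ t z * ∫ y, φ z y ∂μ := by
  have hm : ∀ z, MeasurableSet {y | α.history y u t = z} := fun z =>
    ((α.measurable_history t).comp measurable_prodMk_right) (measurableSet_singleton z)
  have hpt : ∀ y : ℕ → I × I, φ (α.history y u t) (y t) =
      ∑ z, (if α.history y u t = z then 1 else 0) * φ z (y t) := by
    intro y
    simp
  have hmz : ∀ z, Measurable fun y : ℕ → I × I => if α.history y u t = z then (1 : ℝ) else 0 :=
    fun z => Measurable.ite (hm z) measurable_const measurable_const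
  have hmφ : ∀ z, Measurable fun y : ℕ → I × I => φ z (y t) := fun z =>
    (hφ z).comp (measurable_pi_apply t)
  simp_rw [hpt]
  rw [integral_finsetSum]
  · refine Finset.sum_congr rfl fun z _ => ?_
    have hind := (indepFun_history α u μ t).comp (φ := fun z' => if z' = z then (1 : ℝ) else 0)
      (ψ := φ z) (measurable_of_finite _) (hφ z)
    refine (hind.integral_mul_eq_mul_integral (hmz z).aestronglyMeasurable
      (hmφ z).aestronglyMeasurable).trans ?_
    congr 1
    · have : (fun y => if α.history y u t = z then (1 : ℝ) else 0) =
          Set.indicator {y | α.history y u t = z} 1 := by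
        ext y; simp [Set.indicator_apply]
      rw [historyProb, ← integral_indicator_one (hm z), ← this]
      rfl
    · exact integral_eval μ (hφ z) t
  · intro z _
    refine integrable_of_measurable_of_bounded (C := 1) ((hmz z).mul (hmφ z)) fun y =>
      abs_mul_le_one ?_ (hC _ _)
    split_ifs <;> simp

/-- Chain rule: once seeds and history are fixed, the price is deterministic. -/
lemma historyProb_snoc {t : ℕ} (z : Fin t → Bool × Bool) (o : Bool × Bool) :
    historyProb α u μ (t + 1) (Fin.snoc (α := fun _ => Bool × Bool) z o) =
      historyProb α u μ t z * feedbackProb μ (α.price t (fun i => u i, z)) o := by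
  have hm : ∀ p : I, MeasurableSet {y | realisticFeedback p y = o} := fun p =>
    (measurable_realisticFeedback.comp measurable_prodMk_left) (measurableSet_singleton o)
  have hmz : MeasurableSet
      {y | α.history y u (t + 1) = Fin.snoc (α := fun _ => Bool × Bool) z o} :=
    ((α.measurable_history (t + 1)).comp measurable_prodMk_right) (measurableSet_singleton _)
  have h := integral_history α u μ (t := t) (φ := fun z' y =>
    if z' = z then {y | realisticFeedback (α.price t (fun i => u i, z)) y = o}.indicator 1 y else 0)
    (fun z' => by
      by_cases hz : z' = z
      · simpa only [hz, if_true] using measurable_one.indicator (hm _)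
      · simpa only [hz, if_false] using measurable_const)
    (fun z' y => by
      split_ifs
      · simp only [Set.indicator_apply]
        split_ifs <;> simp
      · simp)
  rw [Finset.sum_eq_single z (fun z' _ hz => by simp [hz]) (by simp)] at h
  simp only [if_true] at h
  rw [integral_indicator_one (hm _)] at h
  rw [feedbackProb, ← h, historyProb, ← integral_indicator_one hmz]
  congr 1
  ext y
  simp only [Set.indicator_apply, Set.mem_ofPred_eq, Strategy.history, Fin.snoc_inj, Pi.one_apply]
  by_cases hz : α.history y u t = z
  · simp [hz]
  · simp [hz]

lemma integral_gft_play (t : ℕ) :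
    ∫ y, gft (α.play y u t) (y t) ∂iidLaw μ =
      ∑ z, historyProb α u μ t z * ∫ y, gft (α.price t (fun i => u i, z)) y ∂μ :=
  integral_history α u μ (φ := fun z y => gft (α.price t (fun i => u i, z)) y)
    (fun _ => measurable_gft.comp measurable_prodMk_left) fun _ _ => abs_gft_le _ _

lemma sum_historyProb (t : ℕ) : ∑ z, historyProb α u μ t z = 1 := by
  have h := integral_history α u μ (t := t) (φ := fun _ _ => 1) (fun _ => measurable_const)
    (by simp)
  simpa using h.symm

lemma historyProb_zero (z : Fin 0 → Bool × Bool) : historyProb α u μ 0 z = 1 := by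
  rw [← sum_historyProb α u μ 0, Fintype.sum_subsingleton _ z]

end

/-! ### The two-point game against a strategy with fixed seeds -/

/-- The law of a seller/buyer pair in the hard instance. -/
noncomputable def pairLaw (ε : ℝ) : Measure (I × I) := (sellerLaw ε).prod buyerLaw

lemma isProbabilityMeasure_pairLaw {ε : ℝ} (hε : |ε| ≤ 1) : IsProbabilityMeasure (pairLaw ε) := by
  have := isProbabilityMeasure_sellerLaw hε
  exact inferInstanceAs (IsProbabilityMeasure ((sellerLaw ε).prod buyerLaw))

/-- The sum of the half harmonic means of the probabilities of the histories under `ε` and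
`-ε`. -/
noncomputable def affinity (α : Strategy) (u : ℕ → I) (ε : ℝ) (t : ℕ) : ℝ :=
  ∑ z, halfHarmonic (historyProb α u (pairLaw ε) t z) (historyProb α u (pairLaw (-ε)) t z)

/-- The expected loss with respect to the price `p` in round `t` for fixed seeds. -/
noncomputable def roundRegret (α : Strategy) (u : ℕ → I) (ε : ℝ) (p : I) (t : ℕ) : ℝ :=
  ∫ y, (gft p (y t) - gft (α.play y u t) (y t)) ∂iidLaw (pairLaw ε)

lemma measurable_gft_play (α : Strategy) (t : ℕ) :
    Measurable fun ω : (ℕ → I × I) × (ℕ → I) => gft (α.play ω.1 ω.2 t) (ω.1 t) :=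
  measurable_gft.comp ((α.measurable_play t).prodMk
    ((measurable_pi_apply t).comp measurable_fst))

lemma measurable_gft_eval (p : I) (t : ℕ) : Measurable fun y : ℕ → I × I => gft p (y t) :=
  (measurable_gft.comp measurable_prodMk_left).comp (measurable_pi_apply t)

lemma roundRegret_eq (α : Strategy) (u : ℕ → I) {ε : ℝ} (hε : |ε| ≤ 1) (p : I) (t : ℕ) :
    roundRegret α u ε p t = ∑ z, historyProb α u (pairLaw ε) t z *
      (expectedGain ε p - expectedGain ε (α.price t (fun i => u i, z))) := by
  have := isProbabilityMeasure_pairLaw hε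
  have hplay : Measurable fun y => gft (α.play y u t) (y t) :=
    (measurable_gft_play α t).comp measurable_prodMk_right
  rw [roundRegret, integral_sub
    (integrable_of_measurable_of_bounded (measurable_gft_eval p t) fun _ => abs_gft_le _ _)
    (integrable_of_measurable_of_bounded hplay fun _ => abs_gft_le _ _), integral_gft_play,
    integral_eval _ (φ := gft p) (measurable_gft.comp measurable_prodMk_left)]
  simp_rw [mul_sub, Finset.sum_sub_distrib, ← Finset.sum_mul, sum_historyProb, one_mul]
  rfl

lemma affinity_succ (α : Strategy) (u : ℕ → I) {ε : ℝ} (hε : |ε| ≤ 1) (t : ℕ) :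
    affinity α u ε (t + 1) = ∑ z, ∑ o,
      halfHarmonic
        (historyProb α u (pairLaw ε) t z *
          feedbackProb (pairLaw ε) (α.price t (fun i => u i, z)) o)
        (historyProb α u (pairLaw (-ε)) t z *
          feedbackProb (pairLaw (-ε)) (α.price t (fun i => u i, z)) o) := by
  have := isProbabilityMeasure_pairLaw hε
  have := isProbabilityMeasure_pairLaw (ε := -ε) (by rwa [abs_neg])
  rw [affinity, ← (Fin.snocEquiv fun _ : Fin (t + 1) => Bool × Bool).sum_comp,
    Fintype.sum_prod_type_right]
  refine Finset.sum_congr rfl fun z _ => Finset.sum_congr rfl fun o _ => ?_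
  rw [← historyProb_snoc, ← historyProb_snoc]
  rfl

lemma affinity_step (α : Strategy) (u : ℕ → I) {ε n : ℝ} (h0 : 0 ≤ ε) (h1 : ε ≤ 1) (hn0 : 0 ≤ n)
    (hn : n * ε ^ 3 ≤ 1) (t : ℕ) :
    (n + 1) * (ε / 15 * affinity α u ε t) ≤
      roundRegret α u ε lowPrice t + roundRegret α u (-ε) highPrice t +
        n * (ε / 15 * affinity α u ε (t + 1)) := by
  have hε : |ε| ≤ 1 := abs_le.2 ⟨by linarith, h1⟩
  rw [affinity_succ α u hε, roundRegret_eq α u hε, roundRegret_eq α u (by rwa [abs_neg]), affinity]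
  simp only [Finset.mul_sum, ← Finset.sum_add_distrib]
  refine Finset.sum_le_sum fun z _ => ?_
  have h := halfHarmonic_round h0 h1 hn0 hn (w := historyProb α u (pairLaw ε) t z)
    (v := historyProb α u (pairLaw (-ε)) t z) measureReal_nonneg measureReal_nonneg
    (α.price t (fun i => u i, z))
  simp only [Finset.mul_sum] at h
  exact h

lemma le_sum_roundRegret (α : Strategy) (u : ℕ → I) {ε : ℝ} {T : ℕ} (h0 : 0 ≤ ε) (h1 : ε ≤ 1)
    (hT : T * ε ^ 3 ≤ 1) :
    T * ε / 30 ≤ ∑ t ∈ Finset.range T,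
      (roundRegret α u ε lowPrice t + roundRegret α u (-ε) highPrice t) := by
  have hε : |ε| ≤ 1 := abs_le.2 ⟨by linarith, h1⟩
  have := isProbabilityMeasure_pairLaw hε
  have := isProbabilityMeasure_pairLaw (ε := -ε) (by rwa [abs_neg])
  have hzero : affinity α u ε 0 = 1 / 2 := by
    rw [affinity, Fintype.sum_subsingleton _ default, historyProb_zero, historyProb_zero,
      halfHarmonic]
    norm_num
  -- The potential is the number of remaining rounds times the per-round loss guaranteed by the
  -- current affinity.
  have key : ∀ t ≤ T, (T : ℝ) * (ε / 15 * affinity α u ε 0) ≤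
      ∑ s ∈ Finset.range t,
        (roundRegret α u ε lowPrice s + roundRegret α u (-ε) highPrice s) +
        ((T : ℝ) - t) * (ε / 15 * affinity α u ε t) := by
    intro t
    induction t with
    | zero => simp
    | succ t ih =>
      intro ht
      have ht' : (t : ℝ) + 1 ≤ T := by exact_mod_cast ht
      have hstep := affinity_step α u (n := (T : ℝ) - (t + 1)) h0 h1 (by linarith)
        (le_trans (by gcongr; linarith [(Nat.cast_nonneg t : (0 : ℝ) ≤ t)]) hT) t
      have := ih (by omega)
      rw [Finset.sum_range_succ]
      push_cast
      rw [show (T : ℝ) - (t + 1) + 1 = T - t by ring] at hstep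
      linarith
  have h := key T le_rfl
  rw [hzero, sub_self, zero_mul, add_zero] at h
  linarith

/-! ### The regret over the random seeds -/

/-- Fubini reduces a randomized strategy to the deterministic ones obtained by fixing the seeds. -/
lemma regretAgainst_eq (α : Strategy) {ε : ℝ} (hε : |ε| ≤ 1) (p : I) (T : ℕ) :
    Integrable (fun u => ∑ t ∈ Finset.range T, roundRegret α u ε p t)
      (Measure.infinitePi fun _ : ℕ => (volume : Measure I)) ∧
    regretAgainst T (iidLaw (pairLaw ε)) α p =
      ∫ u, ∑ t ∈ Finset.range T, roundRegret α u ε p t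
        ∂Measure.infinitePi fun _ : ℕ => (volume : Measure I) := by
  have := isProbabilityMeasure_pairLaw hε
  have hm : ∀ t, Measurable fun ω : (ℕ → I × I) × (ℕ → I) =>
      gft p (ω.1 t) - gft (α.play ω.1 ω.2 t) (ω.1 t) := fun t =>
    ((measurable_gft_eval p t).comp measurable_fst).sub (measurable_gft_play α t)
  have hb : ∀ t (ω : (ℕ → I × I) × (ℕ → I)),
      |gft p (ω.1 t) - gft (α.play ω.1 ω.2 t) (ω.1 t)| ≤ 1 + 1 := fun t ω =>
    (abs_sub _ _).trans (add_le_add (abs_gft_le _ _) (abs_gft_le _ _))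
  have hi : ∀ t, Integrable (fun ω : (ℕ → I × I) × (ℕ → I) =>
      gft p (ω.1 t) - gft (α.play ω.1 ω.2 t) (ω.1 t))
      ((iidLaw (pairLaw ε)).prod (Measure.infinitePi fun _ : ℕ => (volume : Measure I))) :=
    fun t => integrable_of_measurable_of_bounded (hm t) (hb t)
  have hr : ∀ t, Integrable (fun u => roundRegret α u ε p t)
      (Measure.infinitePi fun _ : ℕ => (volume : Measure I)) := fun t =>
    (hi t).integral_prod_right
  refine ⟨integrable_finsetSum _ fun t _ => hr t, ?_⟩
  rw [regretAgainst, integral_finsetSum _ fun t _ => hr t]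
  simp_rw [← Finset.sum_sub_distrib]
  rw [integral_finsetSum _ fun t _ => hi t]
  refine Finset.sum_congr rfl fun t _ => ?_
  rw [integral_prod_symm _ (hi t)]
  rfl

lemma le_regretAgainst_add (α : Strategy) {ε : ℝ} {T : ℕ} (h0 : 0 ≤ ε) (h1 : ε ≤ 1)
    (hT : T * ε ^ 3 ≤ 1) :
    T * ε / 30 ≤ regretAgainst T (iidLaw (pairLaw ε)) α lowPrice +
      regretAgainst T (iidLaw (pairLaw (-ε))) α highPrice := by
  have hε : |ε| ≤ 1 := abs_le.2 ⟨by linarith, h1⟩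
  obtain ⟨hi, he⟩ := regretAgainst_eq α hε lowPrice T
  obtain ⟨hi', he'⟩ := regretAgainst_eq α (ε := -ε) (by rwa [abs_neg]) highPrice T
  rw [he, he', ← integral_add hi hi']
  calc T * ε / 30 = ∫ _, T * ε / 30 ∂Measure.infinitePi fun _ : ℕ => (volume : Measure I) := by
        simp
    _ ≤ _ := by
        refine integral_mono (integrable_const _) (hi.add hi') fun u => ?_
        simpa only [Finset.sum_add_distrib] using le_sum_roundRegret α u h0 h1 hT

lemma iidLaw_mem_environments {ε M : ℝ} (hε : |ε| ≤ 1) (hM : 24 ≤ M) :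
    iidLaw (pairLaw ε) ∈ environments M :=
  ⟨sellerLaw ε, buyerLaw, hasDensityBoundedBy_sellerLaw hε hM, hasDensityBoundedBy_buyerLaw hM, rfl⟩

lemma le_minimaxRegret {M ε : ℝ} (hM : 24 ≤ M) {T : ℕ} (h0 : 0 ≤ ε) (h1 : ε ≤ 1)
    (hT : T * ε ^ 3 ≤ 1) : ((T * ε / 60 : ℝ) : EReal) ≤ minimaxRegret M T := by
  have hε : |ε| ≤ 1 := abs_le.2 ⟨by linarith, h1⟩
  refine le_iInf fun α => ?_
  have h := le_regretAgainst_add α h0 h1 hT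
  have hle : ∀ {ε' : ℝ} (_ : |ε'| ≤ 1) (p : I),
      (regretAgainst T (iidLaw (pairLaw ε')) α p : EReal) ≤
        ⨆ P ∈ environments M, regret T P α := fun hε' p =>
    (le_iSup (fun p => (regretAgainst T _ α p : EReal)) p).trans
      (le_iSup₂ (f := fun P (_ : P ∈ environments M) => regret T P α) _
        (iidLaw_mem_environments hε' hM))
  -- One of the two regrets is at least half of their lower bound.
  rcases le_total (T * ε / 60) (regretAgainst T (iidLaw (pairLaw ε)) α lowPrice) with h' | h'
  · exact (EReal.coe_le_coe_iff.2 h').trans (hle hε _)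
  · refine (EReal.coe_le_coe_iff.2 ?_).trans (hle (ε' := -ε) (by rwa [abs_neg]) highPrice)
    linarith

end BilateralTrade


/-! ### Choice of the perturbation. -/

theorem mainTheorem4 (M : ℝ) (hM : 24 ≤ M) (T : ℕ) :
    ((11 / 672 * (T : ℝ) ^ (2 / 3 : ℝ) : ℝ) : EReal) ≤ BilateralTrade.minimaxRegret M T := by
  rcases T.eq_zero_or_pos with rfl | hT
  · refine le_trans ?_ (BilateralTrade.le_minimaxRegret (ε := 0) hM le_rfl zero_le_one (by simp))
    rw [EReal.coe_le_coe_iff]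
    norm_num
  have hT0 : (0 : ℝ) < T := by exact_mod_cast hT
  have hT1 : (1 : ℝ) ≤ T := by exact_mod_cast hT
  -- The largest `ε` allowed by `T * ε ^ 3 ≤ 1`; the constant follows from `11 / 672 ≤ 1 / 60`.
  refine le_trans ?_ (BilateralTrade.le_minimaxRegret (ε := (T : ℝ) ^ (-(1 / 3) : ℝ)) hM
    (by positivity) (Real.rpow_le_one_of_one_le_of_nonpos hT1 (by norm_num)) ?_)
  · rw [EReal.coe_le_coe_iff]
    have h : (T : ℝ) * (T : ℝ) ^ (-(1 / 3) : ℝ) = (T : ℝ) ^ (2 / 3 : ℝ) := by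
      rw [← Real.rpow_one_add' hT0.le (by norm_num)]
      norm_num
    rw [h]
    have : 0 ≤ (T : ℝ) ^ (2 / 3 : ℝ) := by positivity
    linarith
  · rw [← Real.rpow_natCast, ← Real.rpow_mul hT0.le]
    norm_num [Real.rpow_neg_one]
    rw [mul_inv_cancel₀ hT0.ne']
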